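/- Let $R$ be a commutative ring with identity, let $S\subseteq R$ be a multiplicative subset (containing $1$ and closed under multiplication; it may contain zero-divisors), and let $R_S$ be the localization of $R$ at $S$. An $R$-module $C$ is called $S$-weakly cotorsion if $\operatorname{Ext}^1_R(R_S,C)=0$, and an $R$-module $F$ is called $S$-strongly flat if $\operatorname{Ext}^1_R(F,C)=0$ for every $S$-weakly cotorsion $R$-module $C$. A complex $(F,\delta)$ of $R$-modules, indexed by $\mathbb{Z}$, is called $S$-strongly flat if it is acyclic and for every $i\in\mathbb{Z}$ the kernel of $\delta^i\colon F^i\to F^{i+1}$ is an $S$-strongly flat $R$-module. Theorem. Assume that the projective dimension of $R_S$ as an $R$-module is at most $1$. Then every complex $M$ of $R$-modules admits an $S$-strongly flat precover: there are an $S$-strongly flat complex $F$ and a morphism of complexes $f\colon F\to M$ such that for every $S$-strongly flat complex $F'$, every morphism of complexes $F'\to M$ factors through $f$. -/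

import Mathlib

open CategoryTheory Limits

universe u

/-- An `R`-module `C` is `S`-weakly cotorsion if `Ext¹_R(R_S, C) = 0`. -/
def SWeaklyCotorsion {R : Type u} [CommRing R] (S : Submonoid R) :
    ObjectProperty (ModuleCat.{u} R) :=
  fun C => Subsingleton (Abelian.Ext (ModuleCat.of R (Localization S)) C 1)

/-- An `R`-module `F` is `S`-strongly flat if `Ext¹_R(F, C) = 0` for every `S`-weakly cotorsion
`R`-module `C`. -/
def SStronglyFlat {R : Type u} [CommRing R] (S : Submonoid R) :
    ObjectProperty (ModuleCat.{u} R) :=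
  fun F => ∀ C : ModuleCat.{u} R, SWeaklyCotorsion S C → Subsingleton (Abelian.Ext F C 1)

/-- A complex of `R`-modules is `S`-strongly flat if it is acyclic and the kernels of all its
differentials are `S`-strongly flat. -/
def SStronglyFlatComplex {R : Type u} [CommRing R] (S : Submonoid R) :
    ObjectProperty (CochainComplex (ModuleCat.{u} R) ℤ) :=
  fun F => F.Acyclic ∧ ∀ i : ℤ, SStronglyFlat S (kernel (F.d i (i + 1)))

/-- `f : X ⟶ M` is a `P`-precover of `M` if `X` belongs to the class `P` and every morphism to `M`
from an object of `P` factors through `f`. -/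
structure IsPrecover {A : Type*} [Category A] (P : ObjectProperty A) {X M : A} (f : X ⟶ M) :
    Prop where
  mem : P X
  exists_lift : ∀ (X' : A), P X' → ∀ g : X' ⟶ M, ∃ h : X' ⟶ X, h ≫ f = g

/-!
Write `Λ = R_S`. Since `Λ` has projective dimension at most one, weakly cotorsion modules are closed
under quotients; in particular cokernels of injective modules are weakly cotorsion, and it follows
that strongly flat modules have projective dimension at most one
(`SStronglyFlat.projective_syzygy`). The precover of a complex `M` is an epimorphism `F ⟶ M` from a
strongly flat complex whose kernel has weakly cotorsion terms. Two facts carry the proof.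

*Such epimorphisms exist* (`exists_epi_stronglyFlatComplex`). Let `0 → B → A → Λ → 0` be exact with
`A` projective, and let `P ⟶ M` be an epimorphism with kernel `K` from a sum of disk complexes on
projective modules. Attaching to `P` a copy of `A` in a disk for every morphism from `B` to a term
of `K` gives `F`. The quotient `F / P` is a sum of disks on copies of `Λ`, so `F` is strongly flat.
A morphism from `B` to a term of the kernel of `F ⟶ M` extends to `A`: modulo `K` because
`Ext¹(Λ, N) = 0` for every `N` on which `S` acts invertibly (`subsingleton_ext_one_localization`),
and on the remaining part, with values in `K`, by construction. So one step suffices and no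
transfinite iteration is needed.

*Strongly flat complexes lift along such epimorphisms* (`SStronglyFlatComplex.exists_lift`). A
strongly flat complex `F'` has a resolution of length one by sums of disks on projective modules,
which are projective complexes (`SStronglyFlatComplex.exists_diskSum_resolution`). Hence
`Ext¹(F', -)` is right exact on complexes. Every complex `C` with weakly cotorsion terms is a
quotient of the sum `X` of the disks on its terms, and `Ext¹(F', X) = 0`, because morphisms into `X`
are families of linear maps into the terms of `C` and the terms of `F'` are strongly flat. Therefore
`Ext¹(F', C) = 0`. The argument is carried out with extensions of morphisms, so that `Ext` groups of
complexes do not occur.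
-/

/-! ### Pushouts of short exact sequences -/

/-- The pushout of a short exact sequence along a morphism out of its left term is short exact. -/
lemma CategoryTheory.ShortComplex.ShortExact.of_isPushout {A : Type*} [Category A] [Abelian A]
    {T : ShortComplex A} (hT : T.ShortExact) {N E : A}
    {f : T.X₁ ⟶ N} {a : T.X₂ ⟶ E} {i : N ⟶ E} (sq : IsPushout T.f f a i) {q : E ⟶ T.X₃}
    (haq : a ≫ q = T.g) (hiq : i ≫ q = 0) : (ShortComplex.mk i q hiq).ShortExact := by
  have := hT.epi_g
  have hmono : Mono i := (MorphismProperty.monomorphisms A).of_isPushout sq.flip hT.mono_f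
  have : Epi (a ≫ q) := haq ▸ hT.epi_g
  have hepi : Epi q := epi_of_epi a q
  refine
    { exact := ?_
      mono_f := hmono
      epi_g := hepi }
  refine ShortComplex.exact_of_g_is_cokernel _
    (CokernelCofork.IsColimit.ofπ' q hiq fun {W} k hk => ?_)
  have h₁ : T.f ≫ a ≫ k = 0 := by rw [sq.w_assoc, hk, comp_zero]
  refine ⟨hT.exact.desc _ h₁, sq.hom_ext ?_ ?_⟩
  · rw [reassoc_of% haq, hT.exact.g_desc]
  · rw [reassoc_of% hiq, hk, zero_comp]

/-! ### Vanishing of `Ext¹` as an extension property -/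

section Ext

variable {A : Type*} [Category A] [Abelian A] [HasExt A] {T : ShortComplex A}

lemma CategoryTheory.ShortComplex.ShortExact.exists_extension_of_ext_one (hT : T.ShortExact)
    {Y : A} (h : Subsingleton (Abelian.Ext T.X₃ Y 1)) (f : T.X₁ ⟶ Y) :
    ∃ g : T.X₂ ⟶ Y, T.f ≫ g = f := by
  obtain ⟨x, hx⟩ := Abelian.Ext.contravariant_sequence_exact₁ hT Y (Abelian.Ext.mk₀ f)
    (n₁ := 1) rfl (Subsingleton.elim _ _)
  obtain ⟨g, rfl⟩ := Abelian.Ext.addEquiv₀.symm.surjective x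
  refine ⟨g, ?_⟩
  apply Abelian.Ext.addEquiv₀.symm.injective
  simpa using hx

lemma CategoryTheory.ShortComplex.ShortExact.subsingleton_ext_one_of_exists_extension
    (hT : T.ShortExact) [Projective T.X₂] {Y : A}
    (h : ∀ f : T.X₁ ⟶ Y, ∃ g : T.X₂ ⟶ Y, T.f ≫ g = f) :
    Subsingleton (Abelian.Ext T.X₃ Y 1) := by
  refine subsingleton_of_forall_eq 0 fun e => ?_
  obtain ⟨x, rfl⟩ := Abelian.Ext.contravariant_sequence_exact₃ hT Y e
    (Abelian.Ext.eq_zero_of_projective _) (n₀ := 0) rfl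
  obtain ⟨f, rfl⟩ := Abelian.Ext.addEquiv₀.symm.surjective x
  obtain ⟨g, rfl⟩ := h f
  have : Abelian.Ext.addEquiv₀.symm (T.f ≫ g) =
      (Abelian.Ext.mk₀ T.f).comp (Abelian.Ext.mk₀ g) (add_zero 0) := by simp
  rw [this, hT.extClass_comp_assoc]

lemma CategoryTheory.ShortComplex.ShortExact.subsingleton_ext_X₂ (hT : T.ShortExact) {Y : A}
    {n : ℕ} (h₁ : Subsingleton (Abelian.Ext T.X₁ Y n)) (h₃ : Subsingleton (Abelian.Ext T.X₃ Y n)) :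
    Subsingleton (Abelian.Ext T.X₂ Y n) := by
  refine subsingleton_of_forall_eq 0 fun e => ?_
  obtain ⟨x, rfl⟩ := Abelian.Ext.contravariant_sequence_exact₂ hT Y e (Subsingleton.elim _ _)
  rw [Subsingleton.elim x 0, Abelian.Ext.comp_zero]

end Ext

/-! ### Strongly flat modules -/

section StronglyFlat

variable {R : Type u} [CommRing R] {S : Submonoid R}

/-- A short exact sequence `0 → K → P → X → 0` with `P` projective. -/
noncomputable def syzygySequence (X : ModuleCat.{u} R) : ShortComplex (ModuleCat.{u} R) :=
  ShortComplex.mk (kernel.ι (Projective.π X)) (Projective.π X) (kernel.condition _)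

lemma syzygySequence_shortExact (X : ModuleCat.{u} R) : (syzygySequence X).ShortExact where
  exact := ShortComplex.exact_kernel _
  mono_f := inferInstanceAs (Mono (kernel.ι (Projective.π X)))
  epi_g := inferInstanceAs (Epi (Projective.π X))

instance (X : ModuleCat.{u} R) : Projective (syzygySequence X).X₂ :=
  inferInstanceAs (Projective (Projective.over X))

lemma SStronglyFlat.of_shortExact {T : ShortComplex (ModuleCat.{u} R)} (hT : T.ShortExact)
    (h₁ : SStronglyFlat S T.X₁) (h₃ : SStronglyFlat S T.X₃) : SStronglyFlat S T.X₂ :=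
  fun C hC => hT.subsingleton_ext_X₂ (h₁ C hC) (h₃ C hC)

lemma SStronglyFlat.of_projective (P : ModuleCat.{u} R) [Projective P] : SStronglyFlat S P :=
  fun _ _ => Abelian.Ext.subsingleton_of_projective _ _ _

/-- The quotient of an injective module is weakly cotorsion when `R_S` has projective dimension at
most one, by dimension shifting. -/
lemma SWeaklyCotorsion.of_injective_quotient
    [HasProjectiveDimensionLT (ModuleCat.of R (Localization S)) 2]
    {T : ShortComplex (ModuleCat.{u} R)} (hT : T.ShortExact) [Injective T.X₂] :
    SWeaklyCotorsion S T.X₃ := by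
  refine subsingleton_of_forall_eq 0 fun x => ?_
  have h₂ : Subsingleton (Abelian.Ext (ModuleCat.of R (Localization S)) T.X₁ 2) :=
    HasProjectiveDimensionLT.subsingleton _ 2 2 le_rfl _
  obtain ⟨y, rfl⟩ := Abelian.Ext.covariant_sequence_exact₃ _ hT x (n₁ := 2) rfl
    (Subsingleton.elim _ _)
  rw [Abelian.Ext.eq_zero_of_injective y, Abelian.Ext.zero_comp]

/-- Strongly flat modules have projective dimension at most one: for `0 → X → J → J/X → 0` with `J`
injective, a morphism from the syzygy to `J/X` extends to the projective module. -/
lemma SStronglyFlat.projective_syzygy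
    [HasProjectiveDimensionLT (ModuleCat.of R (Localization S)) 2]
    {T : ShortComplex (ModuleCat.{u} R)} (hT : T.ShortExact) [Projective T.X₂]
    (h₃ : SStronglyFlat S T.X₃) : Projective T.X₁ := by
  rw [projective_iff_subsingleton_ext_one]
  intro X
  let U : ShortComplex (ModuleCat.{u} R) :=
    ShortComplex.mk (Injective.ι X) (cokernel.π (Injective.ι X)) (by simp)
  have hU : U.ShortExact :=
    { exact := ShortComplex.exact_cokernel _
      mono_f := inferInstanceAs (Mono (Injective.ι X))
      epi_g := inferInstanceAs (Epi (cokernel.π (Injective.ι X))) }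
  have : Injective U.X₂ := inferInstanceAs (Injective (Injective.under X))
  refine subsingleton_of_forall_eq 0 fun x => ?_
  obtain ⟨y, rfl⟩ := Abelian.Ext.covariant_sequence_exact₁ _ hU x
    (Abelian.Ext.eq_zero_of_injective _) (n₀ := 0) rfl
  obtain ⟨f, rfl⟩ := Abelian.Ext.addEquiv₀.symm.surjective y
  obtain ⟨g, rfl⟩ := hT.exists_extension_of_ext_one
    (h₃ _ (SWeaklyCotorsion.of_injective_quotient hU)) f
  have := hU.epi_g
  have hg : Projective.factorThru g U.g ≫ U.g = g := Projective.factorThru_comp _ _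
  rw [← hg, ← Category.assoc]
  have : Abelian.Ext.addEquiv₀.symm ((T.f ≫ Projective.factorThru g U.g) ≫ U.g) =
      (Abelian.Ext.mk₀ (T.f ≫ Projective.factorThru g U.g)).comp (Abelian.Ext.mk₀ U.g)
        (add_zero 0) := by simp
  rw [this, Abelian.Ext.comp_assoc_of_second_deg_zero, hU.comp_extClass, Abelian.Ext.comp_zero]

/-- Since `R_S` is the localization of `R`, an extension of `R_S` by a module on which `S` acts
invertibly is itself such a module, so a preimage of `1` defines a splitting. -/
lemma subsingleton_ext_one_localization (N : ModuleCat.{u} R)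
    (hN : ∀ s ∈ S, IsIso ((s : R) • 𝟙 N)) : SWeaklyCotorsion S N := by
  let Λ := ModuleCat.of R (Localization S)
  let T := syzygySequence Λ
  have hT : T.ShortExact := syzygySequence_shortExact Λ
  refine hT.subsingleton_ext_one_of_exists_extension fun f => ?_
  have hq : pushout.inr T.f f ≫ pushout.desc T.g 0 (by rw [T.zero, comp_zero]) = 0 :=
    pushout.inr_desc _ _ _
  let U := ShortComplex.mk _ _ hq
  have hU : U.ShortExact :=
    hT.of_isPushout (IsPushout.of_hasPushout T.f f) (pushout.inl_desc _ _ _) hq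
  have hS : ∀ s ∈ S, IsIso ((s : R) • 𝟙 U.X₂) := by
    intro s hs
    let φ : U ⟶ U := (s : R) • 𝟙 U
    have h₁ : IsIso φ.τ₁ := hN s hs
    have h₃ : IsIso φ.τ₃ := by
      rw [ConcreteCategory.isIso_iff_bijective, ← Module.End.isUnit_iff]
      exact IsLocalizedModule.map_units (Algebra.linearMap R (Localization S)) ⟨s, hs⟩
    exact ShortComplex.isIso₂_of_shortExact_of_isIso₁₃ φ hU hU
  have hS' (s : S) : IsUnit (algebraMap R (Module.End R U.X₂) s) := by
    have := hS s s.2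
    rw [ConcreteCategory.isIso_iff_bijective] at this
    exact (Module.End.isUnit_iff _).2 this
  obtain ⟨e, he⟩ := hU.moduleCat_surjective_g (1 : Localization S)
  let σ : Localization S →ₗ[R] U.X₂ :=
    IsLocalizedModule.lift S (Algebra.linearMap R (Localization S))
      (LinearMap.toSpanSingleton R U.X₂ e) hS'
  have hσ : ModuleCat.ofHom σ ≫ U.g = 𝟙 Λ := by
    ext1
    refine IsLocalizedModule.ext S (Algebra.linearMap R (Localization S))
      (IsLocalizedModule.map_units (Algebra.linearMap R (Localization S))) ?_
    ext
    change U.g.hom (σ (algebraMap R (Localization S) 1)) = algebraMap R (Localization S) 1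
    have h : σ (algebraMap R (Localization S) 1) = (1 : R) • e :=
      IsLocalizedModule.lift_apply S (Algebra.linearMap R (Localization S))
        (LinearMap.toSpanSingleton R U.X₂ e) hS' 1
    rw [h, one_smul, map_one]
    exact he
  have spl := ShortComplex.Splitting.ofExactOfSection U hU.exact (ModuleCat.ofHom σ) hσ hU.mono_f
  refine ⟨pushout.inl T.f f ≫ spl.r, ?_⟩
  rw [pushout.condition_assoc]
  exact (congrArg (f ≫ ·) spl.f_r).trans (Category.comp_id f)

end StronglyFlat

/-! ### Direct sums of disk complexes -/

section DiskSum

variable {R : Type u} [CommRing R]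

/-- The direct sum over `n` of the disk complexes with the module `Q n` in degrees `n - 1` and `n`:
the complex with term `Q n × Q (n + 1)` in degree `n` and differential `(a, b) ↦ (b, 0)`. -/
noncomputable def diskSum (Q : ℤ → ModuleCat.{u} R) : CochainComplex (ModuleCat.{u} R) ℤ :=
  CochainComplex.of (fun n => ModuleCat.of R (Q n × Q (n + 1)))
    (fun _ => ModuleCat.ofHom (LinearMap.inl R _ _ ∘ₗ LinearMap.snd R _ _))
    (fun _ => by ext <;> simp)

lemma acyclic_iff_forall_exists (K : CochainComplex (ModuleCat.{u} R) ℤ) :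
    K.Acyclic ↔ ∀ n, ∀ x : K.X (n + 1), K.d (n + 1) (n + 1 + 1) x = 0 →
      ∃ y : K.X n, K.d n (n + 1) y = x := by
  have key (n : ℤ) : K.ExactAt (n + 1) ↔ ∀ x : K.X (n + 1), K.d (n + 1) (n + 1 + 1) x = 0 →
      ∃ y : K.X n, K.d n (n + 1) y = x := by
    rw [K.exactAt_iff' n (n + 1) (n + 1 + 1) (by simp) (by simp),
      ShortComplex.moduleCat_exact_iff]
    rfl
  refine ⟨fun h n => (key n).1 (h _), fun h n => ?_⟩
  obtain ⟨n, rfl⟩ : ∃ m, n = m + 1 := ⟨n - 1, by simp⟩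
  exact (key n).2 (h n)

namespace diskSum

variable {Q Q' : ℤ → ModuleCat.{u} R} {Y : CochainComplex (ModuleCat.{u} R) ℤ}

/-- The inclusion of the summand of cycles in degree `n`. -/
noncomputable def inl (Q : ℤ → ModuleCat.{u} R) (n : ℤ) : Q n ⟶ (diskSum Q).X n :=
  ModuleCat.ofHom (LinearMap.inl R (Q n) (Q (n + 1)))

/-- The inclusion in degree `n` of the summand on which the differential is injective. -/
noncomputable def inr (Q : ℤ → ModuleCat.{u} R) (n : ℤ) : Q (n + 1) ⟶ (diskSum Q).X n :=
  ModuleCat.ofHom (LinearMap.inr R (Q n) (Q (n + 1)))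

/-- The projection in degree `n` to the summand of cycles. -/
noncomputable def fst (Q : ℤ → ModuleCat.{u} R) (n : ℤ) : (diskSum Q).X n ⟶ Q n :=
  ModuleCat.ofHom (LinearMap.fst R (Q n) (Q (n + 1)))

/-- The projection in degree `n` to the summand on which the differential is injective. -/
noncomputable def snd (Q : ℤ → ModuleCat.{u} R) (n : ℤ) : (diskSum Q).X n ⟶ Q (n + 1) :=
  ModuleCat.ofHom (LinearMap.snd R (Q n) (Q (n + 1)))

lemma d_eq (n : ℤ) : (diskSum Q).d n (n + 1) = snd Q n ≫ inl Q (n + 1) :=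
  CochainComplex.of_d (fun n => ModuleCat.of R (Q n × Q (n + 1)))
    (fun _ => ModuleCat.ofHom (LinearMap.inl R _ _ ∘ₗ LinearMap.snd R _ _)) n

@[simp]
lemma inl_fst (n : ℤ) : inl Q n ≫ fst Q n = 𝟙 _ := rfl

@[simp]
lemma inl_snd (n : ℤ) : inl Q n ≫ snd Q n = 0 := rfl

@[simp]
lemma inr_fst (n : ℤ) : inr Q n ≫ fst Q n = 0 := rfl

@[simp]
lemma inr_snd (n : ℤ) : inr Q n ≫ snd Q n = 𝟙 _ := rfl

@[simp]
lemma inl_fst_assoc (n : ℤ) {M : ModuleCat.{u} R} (f : Q n ⟶ M) :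
    inl Q n ≫ fst Q n ≫ f = f := rfl

@[simp]
lemma inr_fst_assoc (n : ℤ) {M : ModuleCat.{u} R} (f : Q n ⟶ M) :
    inr Q n ≫ fst Q n ≫ f = 0 := by
  rw [← Category.assoc, inr_fst, zero_comp]

@[simp]
lemma inl_snd_assoc (n : ℤ) {M : ModuleCat.{u} R} (f : Q (n + 1) ⟶ M) :
    inl Q n ≫ snd Q n ≫ f = 0 := by
  rw [← Category.assoc, inl_snd, zero_comp]

@[simp]
lemma inr_snd_assoc (n : ℤ) {M : ModuleCat.{u} R} (f : Q (n + 1) ⟶ M) :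
    inr Q n ≫ snd Q n ≫ f = f := rfl

lemma inl_d (n : ℤ) : inl Q n ≫ (diskSum Q).d n (n + 1) = 0 := by
  rw [d_eq, inl_snd_assoc]

lemma inr_d (n : ℤ) : inr Q n ≫ (diskSum Q).d n (n + 1) = inl Q (n + 1) := by
  rw [d_eq, inr_snd_assoc]

lemma d_fst (n : ℤ) : (diskSum Q).d n (n + 1) ≫ fst Q (n + 1) = snd Q n := by
  rw [d_eq, Category.assoc, inl_fst, Category.comp_id]

lemma total (n : ℤ) : fst Q n ≫ inl Q n + snd Q n ≫ inr Q n = 𝟙 _ := by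
  ext x
  exact Prod.ext (add_zero _) (zero_add _)

lemma hom_X_ext {n : ℤ} {M : ModuleCat.{u} R} {f g : (diskSum Q).X n ⟶ M}
    (h₁ : inl Q n ≫ f = inl Q n ≫ g) (h₂ : inr Q n ≫ f = inr Q n ≫ g) : f = g := by
  rw [← Category.id_comp f, ← Category.id_comp g, ← total]
  simp [h₁, h₂]

lemma X_hom_ext {n : ℤ} {M : ModuleCat.{u} R} {f g : M ⟶ (diskSum Q).X n}
    (h₁ : f ≫ fst Q n = g ≫ fst Q n) (h₂ : f ≫ snd Q n = g ≫ snd Q n) : f = g := by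
  rw [← Category.comp_id f, ← Category.comp_id g, ← total, Preadditive.comp_add,
    Preadditive.comp_add, ← Category.assoc, ← Category.assoc, h₁, h₂]
  simp

/-- A morphism out of `diskSum Q` is determined by its restrictions to the summands `inr`. -/
lemma hom_ext {f g : diskSum Q ⟶ Y} (h : ∀ n, inr Q n ≫ f.f n = inr Q n ≫ g.f n) : f = g := by
  ext1 n
  obtain ⟨n, rfl⟩ : ∃ m, n = m + 1 := ⟨n - 1, by simp⟩
  refine hom_X_ext ?_ (h _)
  rw [← inr_d, Category.assoc, Category.assoc, ← f.comm, ← g.comm, ← Category.assoc,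
    ← Category.assoc, h]

/-- A morphism into `diskSum Q` is determined by its projections to the summands `fst`. -/
lemma hom_ext' {f g : Y ⟶ diskSum Q} (h : ∀ n, f.f n ≫ fst Q n = g.f n ≫ fst Q n) : f = g := by
  ext1 n
  refine X_hom_ext (h _) ?_
  rw [← d_fst, ← Category.assoc, ← Category.assoc, f.comm, g.comm, Category.assoc, Category.assoc,
    h]

/-- The restriction to `inl Q n` of the morphism `desc β`, forced by compatibility with the
differentials. -/
noncomputable def descInl (β : ∀ n, Q (n + 1) ⟶ Y.X n) (n : ℤ) : Q n ⟶ Y.X n :=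
  eqToHom (by rw [sub_add_cancel]) ≫ β (n - 1) ≫ Y.d (n - 1) n

lemma descInl_succ (β : ∀ n, Q (n + 1) ⟶ Y.X n) (n : ℤ) :
    descInl β (n + 1) = β n ≫ Y.d n (n + 1) := by
  have key : ∀ (m : ℤ) (h : m = n) (h' : Q (n + 1) = Q (m + 1)),
      eqToHom h' ≫ β m ≫ Y.d m (n + 1) = β n ≫ Y.d n (n + 1) := by
    rintro m rfl _
    simp
  exact key _ (add_sub_cancel_right n 1) _

/-- The morphism out of `diskSum Q` with prescribed restrictions to the summands `inr Q n`. -/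
noncomputable def desc (β : ∀ n, Q (n + 1) ⟶ Y.X n) : diskSum Q ⟶ Y :=
  CochainComplex.ofHom (fun n => fst Q n ≫ descInl β n + snd Q n ≫ β n) fun n => by
    rw [d_eq]
    apply hom_X_ext
    · simp [descInl]
    · simp [descInl_succ]

@[simp]
lemma inr_desc (β : ∀ n, Q (n + 1) ⟶ Y.X n) (n : ℤ) : inr Q n ≫ (desc β).f n = β n := by
  simp [desc]

/-- The morphism to `diskSum Q` with prescribed projections to the summands `fst Q n`. -/
noncomputable def lift (γ : ∀ n, Y.X n ⟶ Q n) : Y ⟶ diskSum Q :=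
  CochainComplex.ofHom (fun n => γ n ≫ inl Q n + (Y.d n (n + 1) ≫ γ (n + 1)) ≫ inr Q n) fun n => by
    rw [d_eq]
    apply X_hom_ext <;> simp

@[simp]
lemma lift_fst (γ : ∀ n, Y.X n ⟶ Q n) (n : ℤ) : (lift γ).f n ≫ fst Q n = γ n := by
  simp [lift]

/-- The morphism of sums of disks induced by a family of linear maps. -/
noncomputable def map (φ : ∀ n, Q n ⟶ Q' n) : diskSum Q ⟶ diskSum Q' :=
  lift fun n => fst Q n ≫ φ n

lemma map_f_fst (φ : ∀ n, Q n ⟶ Q' n) (n : ℤ) :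
    (map φ).f n ≫ fst Q' n = fst Q n ≫ φ n := lift_fst _ _

lemma map_f_snd (φ : ∀ n, Q n ⟶ Q' n) (n : ℤ) :
    (map φ).f n ≫ snd Q' n = snd Q n ≫ φ (n + 1) := by
  rw [← d_fst, ← Category.assoc, (map φ).comm, Category.assoc, map_f_fst, ← Category.assoc, d_fst]

lemma inr_map (φ : ∀ n, Q n ⟶ Q' n) (n : ℤ) :
    inr Q n ≫ (map φ).f n = φ (n + 1) ≫ inr Q' n := by
  apply X_hom_ext <;> simp [map_f_fst, map_f_snd]

lemma inl_map (φ : ∀ n, Q n ⟶ Q' n) (n : ℤ) :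
    inl Q n ≫ (map φ).f n = φ n ≫ inl Q' n := by
  apply X_hom_ext <;> simp [map_f_fst, map_f_snd]

/-- Sums of disks on projective modules are projective complexes. -/
lemma projective [∀ n, Projective (Q n)] : Projective (diskSum Q) where
  factors {E X} f e _ :=
    ⟨desc fun n => Projective.factorThru (inr Q n ≫ f.f n) (e.f n), hom_ext fun n => by
      rw [HomologicalComplex.comp_f, ← Category.assoc, inr_desc, Projective.factorThru_comp]⟩

lemma inl_fst_of_d_eq_zero {n : ℤ} {x : (diskSum Q).X n}
    (hx : (diskSum Q).d n (n + 1) x = 0) : inl Q n (fst Q n x) = x := by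
  have h : snd Q n x = 0 := by
    rw [← d_fst, ModuleCat.comp_apply, hx, map_zero]
  have := ConcreteCategory.congr_hom (total (Q := Q) n) x
  simpa [h] using this

lemma acyclic : (diskSum Q).Acyclic := by
  rw [acyclic_iff_forall_exists]
  intro n x hx
  refine ⟨inr Q n (fst Q (n + 1) x), ?_⟩
  rw [← ModuleCat.comp_apply, inr_d, inl_fst_of_d_eq_zero hx]

lemma X_ext {n : ℤ} {x y : (diskSum Q).X n} (h₁ : fst Q n x = fst Q n y)
    (h₂ : snd Q n x = snd Q n y) : x = y :=
  Prod.ext h₁ h₂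

lemma isIso_smul {s : R} (h : ∀ n, IsIso (s • 𝟙 (Q n))) (n : ℤ) :
    IsIso (s • 𝟙 ((diskSum Q).X n)) := by
  have h' (m : ℤ) : s • inv (s • 𝟙 (Q m)) = 𝟙 _ := by
    have := IsIso.hom_inv_id (s • 𝟙 (Q m))
    rwa [Linear.smul_comp, Category.id_comp] at this
  have h₁ : s • (fst Q n ≫ inv (s • 𝟙 (Q n)) ≫ inl Q n) = fst Q n ≫ inl Q n := by
    rw [← Linear.comp_smul, ← Linear.smul_comp, h', Category.id_comp]
  have h₂ : s • (snd Q n ≫ inv (s • 𝟙 (Q (n + 1))) ≫ inr Q n) = snd Q n ≫ inr Q n := by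
    rw [← Linear.comp_smul, ← Linear.smul_comp, h', Category.id_comp]
  have key : s • (fst Q n ≫ inv (s • 𝟙 (Q n)) ≫ inl Q n +
      snd Q n ≫ inv (s • 𝟙 (Q (n + 1))) ≫ inr Q n) = 𝟙 _ := by
    rw [smul_add, h₁, h₂, total]
  exact ⟨_, by rw [Linear.smul_comp, Category.id_comp, key],
    by rw [Linear.comp_smul, Category.comp_id, key]⟩

lemma map_comp_map_eq_zero {Q'' : ℤ → ModuleCat.{u} R} {φ : ∀ n, Q n ⟶ Q' n}
    {ψ : ∀ n, Q' n ⟶ Q'' n} (w : ∀ n, φ n ≫ ψ n = 0) : map φ ≫ map ψ = 0 :=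
  hom_ext' fun n => by simp [map_f_fst, w, reassoc_of% map_f_fst]

lemma shortExact_map {Q'' : ℤ → ModuleCat.{u} R} {φ : ∀ n, Q n ⟶ Q' n} {ψ : ∀ n, Q' n ⟶ Q'' n}
    (w : ∀ n, φ n ≫ ψ n = 0) (h : ∀ n, (ShortComplex.mk _ _ (w n)).ShortExact) :
    (ShortComplex.mk (map φ) (map ψ) (map_comp_map_eq_zero w)).ShortExact := by
  have hinj (n : ℤ) : Function.Injective (φ n) := (h n).moduleCat_injective_f
  have hsurj (n : ℤ) : Function.Surjective (ψ n) := (h n).moduleCat_surjective_g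
  have hex (n : ℤ) := (ShortComplex.moduleCat_exact_iff _).1 (h n).exact
  refine HomologicalComplex.shortExact_of_degreewise_shortExact _ fun n => ?_
  refine
    { exact := ?_
      mono_f := ?_
      epi_g := ?_ }
  · rw [ShortComplex.moduleCat_exact_iff]
    intro (x : (diskSum Q').X n) (hx : (map ψ).f n x = 0)
    obtain ⟨a, ha⟩ := hex n (fst Q' n x) (by
      change ψ n _ = 0
      rw [← ModuleCat.comp_apply, ← map_f_fst, ModuleCat.comp_apply, hx, map_zero])
    obtain ⟨b, hb⟩ := hex (n + 1) (snd Q' n x) (by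
      change ψ (n + 1) _ = 0
      rw [← ModuleCat.comp_apply, ← map_f_snd, ModuleCat.comp_apply, hx, map_zero])
    refine ⟨inl Q n a + inr Q n b, ?_⟩
    change (map φ).f n _ = x
    rw [map_add, ← ModuleCat.comp_apply, ← ModuleCat.comp_apply, inl_map, inr_map,
      ModuleCat.comp_apply, ModuleCat.comp_apply]
    exact Prod.ext ((add_zero _).trans ha) ((zero_add _).trans hb)
  · refine (ModuleCat.mono_iff_injective ((map φ).f n)).2 fun x y hxy => ?_
    refine X_ext (hinj _ ?_) (hinj _ ?_)
    · rw [← ModuleCat.comp_apply, ← map_f_fst, ModuleCat.comp_apply, hxy,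
        ← ModuleCat.comp_apply, map_f_fst, ModuleCat.comp_apply]
    · rw [← ModuleCat.comp_apply, ← map_f_snd, ModuleCat.comp_apply, hxy,
        ← ModuleCat.comp_apply, map_f_snd, ModuleCat.comp_apply]
  · refine (ModuleCat.epi_iff_surjective ((map ψ).f n)).2 fun x => ?_
    obtain ⟨a, ha⟩ := hsurj n (fst Q'' n x)
    obtain ⟨b, hb⟩ := hsurj (n + 1) (snd Q'' n x)
    refine ⟨inl Q' n a + inr Q' n b, ?_⟩
    rw [map_add, ← ModuleCat.comp_apply, ← ModuleCat.comp_apply, inl_map, inr_map,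
      ModuleCat.comp_apply, ModuleCat.comp_apply]
    exact Prod.ext ((add_zero _).trans ha) ((zero_add _).trans hb)

/-- The morphism to `Y` from the sum of disks with `G n` in degrees `n` and `n + 1`, with
restriction `β n` to the summand `G n` in degree `n`. -/
noncomputable def descShift {G : ℤ → ModuleCat.{u} R} (β : ∀ n, G n ⟶ Y.X n) :
    diskSum (fun n => G (n - 1)) ⟶ Y :=
  desc fun n => eqToHom (by rw [add_sub_cancel_right]) ≫ β n

lemma inr_descShift {G : ℤ → ModuleCat.{u} R} (β : ∀ n, G n ⟶ Y.X n) (n : ℤ) :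
    inr (fun n => G (n - 1)) n ≫ (descShift β).f n =
      eqToHom (by rw [add_sub_cancel_right]) ≫ β n :=
  inr_desc _ _

lemma epi_descShift {G : ℤ → ModuleCat.{u} R} (β : ∀ n, G n ⟶ Y.X n) [∀ n, Epi (β n)] :
    Epi (descShift β) := by
  have h (n : ℤ) : Epi ((descShift β).f n) := by
    have : Epi (inr (fun n => G (n - 1)) n ≫ (descShift β).f n) := by
      rw [inr_descShift]
      infer_instance
    exact epi_of_epi (inr (fun n => G (n - 1)) n) _
  exact HomologicalComplex.epi_of_epi_f _ h

end diskSum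
end DiskSum

/-! ### Strongly flat complexes -/

section StronglyFlatComplex

variable {R : Type u} [CommRing R] {S : Submonoid R}

/-- In an acyclic complex of modules, the differential is an epimorphism onto the next kernel. -/
lemma HomologicalComplex.Acyclic.epi_kernel_lift {F : CochainComplex (ModuleCat.{u} R) ℤ}
    (hF : F.Acyclic) (n : ℤ) :
    Epi (kernel.lift (F.d (n + 1) (n + 1 + 1)) (F.d n (n + 1)) (F.d_comp_d _ _ _)) := by
  rw [ModuleCat.epi_iff_surjective]
  intro z
  obtain ⟨y, hy⟩ := (acyclic_iff_forall_exists F).1 hF n (kernel.ι (F.d (n + 1) (n + 1 + 1)) z) (by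
    rw [← ModuleCat.comp_apply, kernel.condition]; rfl)
  refine ⟨y, (ModuleCat.mono_iff_injective (kernel.ι (F.d (n + 1) (n + 1 + 1)))).1
    inferInstance ?_⟩
  rw [← ModuleCat.comp_apply, kernel.lift_ι, hy]

/-- The terms of a strongly flat complex are strongly flat, as extensions of its kernels. -/
lemma SStronglyFlatComplex.stronglyFlat_X {F : CochainComplex (ModuleCat.{u} R) ℤ}
    (hF : SStronglyFlatComplex S F) (n : ℤ) : SStronglyFlat S (F.X n) := by
  have hepi := hF.1.epi_kernel_lift n
  let κ := kernel.lift (F.d (n + 1) (n + 1 + 1)) (F.d n (n + 1)) (F.d_comp_d _ _ _)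
  have w : kernel.ι (F.d n (n + 1)) ≫ κ = 0 := by
    rw [← cancel_mono (kernel.ι _), Category.assoc, kernel.lift_ι, kernel.condition, zero_comp]
  have hT : (ShortComplex.mk _ _ w).ShortExact :=
    { exact := by
        rw [ShortComplex.moduleCat_exact_iff]
        intro x hx
        have hx' : F.d n (n + 1) x = 0 := by
          have : κ ≫ kernel.ι _ = F.d n (n + 1) := kernel.lift_ι _ _ _
          rw [← this, ModuleCat.comp_apply]
          exact (congrArg _ hx).trans (map_zero _)
        exact (ShortComplex.moduleCat_exact_iff _).1
          (ShortComplex.exact_kernel (F.d n (n + 1))) x hx'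
      mono_f := inferInstanceAs (Mono (kernel.ι _))
      epi_g := hepi }
  exact SStronglyFlat.of_shortExact hT (hF.2 n) (hF.2 (n + 1))

/-- An extension of sums of disks on strongly flat modules is a strongly flat complex: since the
subcomplex is acyclic, the kernels of the differentials again form a short exact sequence. -/
lemma SStronglyFlatComplex.of_shortExact_diskSum {Q V : ℤ → ModuleCat.{u} R}
    {F : CochainComplex (ModuleCat.{u} R) ℤ} {i : diskSum Q ⟶ F} {q : F ⟶ diskSum V}
    {w : i ≫ q = 0} (hT : (ShortComplex.mk i q w).ShortExact) (hQ : ∀ n, SStronglyFlat S (Q n))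
    (hV : ∀ n, SStronglyFlat S (V n)) : SStronglyFlatComplex S F := by
  refine ⟨hT.acyclic_X₂ diskSum.acyclic diskSum.acyclic,
    fun n => ?_⟩
  have hTn (n : ℤ) := (HomologicalComplex.shortExact_iff_degreewise_shortExact _).1 hT n
  have hinj (n : ℤ) : Function.Injective (i.f n) := (hTn n).moduleCat_injective_f
  have hsurj (n : ℤ) : Function.Surjective (q.f n) := (hTn n).moduleCat_surjective_g
  have hex (n : ℤ) (x : F.X n) (hx : q.f n x = 0) : ∃ y, i.f n y = x :=
    (ShortComplex.moduleCat_exact_iff _).1 (hTn n).exact x hx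
  have hi (n : ℤ) (x) : F.d n (n + 1) (i.f n x) = i.f (n + 1) ((diskSum Q).d n (n + 1) x) := by
    rw [← ModuleCat.comp_apply, i.comm, ModuleCat.comp_apply]
  have hq (n : ℤ) (x) : (diskSum V).d n (n + 1) (q.f n x) = q.f (n + 1) (F.d n (n + 1) x) := by
    rw [← ModuleCat.comp_apply, q.comm, ModuleCat.comp_apply]
  let f : Q n ⟶ kernel (F.d n (n + 1)) :=
    kernel.lift _ (diskSum.inl Q n ≫ i.f n) (by
      rw [Category.assoc, i.comm, ← Category.assoc, diskSum.inl_d, zero_comp])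
  have hf : f ≫ kernel.ι _ = diskSum.inl Q n ≫ i.f n := kernel.lift_ι _ _ _
  let g : kernel (F.d n (n + 1)) ⟶ V n := kernel.ι _ ≫ q.f n ≫ diskSum.fst V n
  have hιinj : Function.Injective (kernel.ι (F.d n (n + 1))) :=
    (ModuleCat.mono_iff_injective _).1 inferInstance
  have hι (x : ↑(kernel (F.d n (n + 1)))) : F.d n (n + 1) (kernel.ι (F.d n (n + 1)) x) = 0 := by
    rw [← ModuleCat.comp_apply, kernel.condition]; rfl
  have hker (x : F.X n) (hx : F.d n (n + 1) x = 0) :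
      ∃ z, kernel.ι (F.d n (n + 1)) z = x :=
    (ShortComplex.moduleCat_exact_iff _).1 (ShortComplex.exact_kernel (F.d n (n + 1))) x hx
  have hwn : i.f n ≫ q.f n = 0 := by
    rw [← HomologicalComplex.comp_f, w]; rfl
  have wfg : f ≫ g = 0 := by
    rw [← Category.assoc, hf, Category.assoc, reassoc_of% hwn, zero_comp, comp_zero]
  have hU : (ShortComplex.mk f g wfg).ShortExact := by
    refine
      { exact := ?_
        mono_f := ?_
        epi_g := ?_ }
    · rw [ShortComplex.moduleCat_exact_iff]
      intro (x : ↑(kernel (F.d n (n + 1)))) (hx : g x = 0)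
      have h₁ : q.f n (kernel.ι (F.d n (n + 1)) x) = 0 := by
        rw [← diskSum.inl_fst_of_d_eq_zero (x := q.f n (kernel.ι (F.d n (n + 1)) x)) (by
          rw [hq, hι, map_zero])]
        exact (congrArg _ hx).trans (map_zero _)
      obtain ⟨y, hy⟩ := hex n _ h₁
      have hy' : (diskSum Q).d n (n + 1) y = 0 := by
        apply hinj
        rw [← hi, hy, hι, map_zero]
      refine ⟨diskSum.fst Q n y, hιinj ?_⟩
      change kernel.ι (F.d n (n + 1)) (f _) = _
      rw [← ModuleCat.comp_apply, hf, ModuleCat.comp_apply, diskSum.inl_fst_of_d_eq_zero hy', hy]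
    · rw [ModuleCat.mono_iff_injective]
      intro x y (hxy : f x = f y)
      have h : (f ≫ kernel.ι _) x = (f ≫ kernel.ι _) y := by
        rw [ModuleCat.comp_apply, ModuleCat.comp_apply, hxy]
      rw [hf, ModuleCat.comp_apply, ModuleCat.comp_apply] at h
      exact congrArg (diskSum.fst Q n) (hinj n h)
    · rw [ModuleCat.epi_iff_surjective]
      intro (v : V n)
      obtain ⟨x, hx⟩ := hsurj n (diskSum.inl V n v)
      -- A lift `x` of the cycle `v` has its differential in the acyclic subcomplex, so it can be
      -- corrected to a cycle.
      obtain ⟨y, hy⟩ := hex (n + 1) (F.d n (n + 1) x) (by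
        rw [← hq, hx, ← ModuleCat.comp_apply, diskSum.inl_d]; rfl)
      obtain ⟨z, hz⟩ := (acyclic_iff_forall_exists _).1 (diskSum.acyclic (Q := Q)) n y (by
        apply hinj
        rw [← hi, hy, ← ModuleCat.comp_apply, F.d_comp_d, map_zero]; rfl)
      obtain ⟨t, ht⟩ := hker (x - i.f n z) (by rw [map_sub, hi, hz, hy, sub_self])
      refine ⟨t, ?_⟩
      change diskSum.fst V n (q.f n (kernel.ι (F.d n (n + 1)) t)) = v
      rw [ht, map_sub, hx, ← ModuleCat.comp_apply (i.f n), hwn]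
      exact congrArg (diskSum.fst V n) (sub_zero (diskSum.inl V n v))
  exact SStronglyFlat.of_shortExact hU (hQ n) (hV n)

/-- A strongly flat complex has projective dimension at most one in the category of complexes. The
resolution is spliced from projective resolutions of length one of the kernels; both of its terms
are sums of disks. -/
lemma SStronglyFlatComplex.exists_diskSum_resolution
    [HasProjectiveDimensionLT (ModuleCat.of R (Localization S)) 2]
    {F : CochainComplex (ModuleCat.{u} R) ℤ} (hF : SStronglyFlatComplex S F) :
    ∃ (L Q : ℤ → ModuleCat.{u} R) (i : diskSum L ⟶ diskSum Q) (π : diskSum Q ⟶ F)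
      (w : i ≫ π = 0), (∀ n, Projective (L n)) ∧ (∀ n, Projective (Q n)) ∧
        (ShortComplex.mk i π w).ShortExact := by
  let Q (n : ℤ) : ModuleCat.{u} R := Projective.over (kernel (F.d n (n + 1)))
  let ρ (n : ℤ) : Q n ⟶ kernel (F.d n (n + 1)) := Projective.π _
  let a (n : ℤ) : Q n ⟶ F.X n := ρ n ≫ kernel.ι _
  let L (n : ℤ) : ModuleCat.{u} R := kernel (ρ n)
  let l (n : ℤ) : L n ⟶ Q n := kernel.ι (ρ n)
  have hQ (n : ℤ) : Projective (Q n) := inferInstanceAs (Projective (Projective.over _))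
  have hla (n : ℤ) : l n ≫ a n = 0 := by
    rw [← Category.assoc, kernel.condition, zero_comp]
  have hSES (n : ℤ) : (ShortComplex.mk (l n) (ρ n) (kernel.condition _)).ShortExact :=
    syzygySequence_shortExact _
  have hL (n : ℤ) : Projective (L n) := by
    have : Projective (ShortComplex.mk (l n) (ρ n) (kernel.condition _)).X₂ := hQ n
    exact SStronglyFlat.projective_syzygy (hSES n) (hF.2 n)
  have hb (n : ℤ) : ∃ b : Q (n + 1) ⟶ F.X n, b ≫ F.d n (n + 1) = a (n + 1) := by
    have := hF.1.epi_kernel_lift n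
    refine ⟨Projective.factorThru (ρ (n + 1)) (kernel.lift _ _ (F.d_comp_d n (n + 1) _)), ?_⟩
    have h := Projective.factorThru_comp (ρ (n + 1)) (kernel.lift _ _ (F.d_comp_d n (n + 1) _))
    change _ = ρ (n + 1) ≫ kernel.ι _
    exact (congrArg (_ ≫ ·) (kernel.lift_ι _ _ (F.d_comp_d n (n + 1) _)).symm).trans
      ((Category.assoc _ _ _).symm.trans (congrArg (· ≫ kernel.ι _) h))
  choose b hb using hb
  have ht (n : ℤ) : ∃ t : L (n + 1) ⟶ Q n, t ≫ a n = -(l (n + 1) ≫ b n) := by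
    have h : (-(l (n + 1) ≫ b n)) ≫ F.d n (n + 1) = 0 := by
      rw [Preadditive.neg_comp, Category.assoc, hb, hla, neg_zero]
    refine ⟨Projective.factorThru (kernel.lift _ _ h) (ρ n), ?_⟩
    rw [← Category.assoc, Projective.factorThru_comp, kernel.lift_ι]
  choose t ht using ht
  let π : diskSum Q ⟶ F := diskSum.desc b
  have hπr (n : ℤ) : diskSum.inr Q n ≫ π.f n = b n := diskSum.inr_desc _ _
  have hπl (n : ℤ) : diskSum.inl Q n ≫ π.f n = a n := by
    obtain ⟨n, rfl⟩ : ∃ m, n = m + 1 := ⟨n - 1, by simp⟩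
    rw [← diskSum.inr_d, Category.assoc, ← π.comm, reassoc_of% hπr, hb]
  let i : diskSum L ⟶ diskSum Q :=
    diskSum.desc fun n => t n ≫ diskSum.inl Q n + l (n + 1) ≫ diskSum.inr Q n
  have hir (n : ℤ) : diskSum.inr L n ≫ i.f n =
      t n ≫ diskSum.inl Q n + l (n + 1) ≫ diskSum.inr Q n := diskSum.inr_desc _ _
  have hil (n : ℤ) : diskSum.inl L n ≫ i.f n = l n ≫ diskSum.inl Q n := by
    obtain ⟨n, rfl⟩ : ∃ m, n = m + 1 := ⟨n - 1, by simp⟩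
    rw [← diskSum.inr_d, Category.assoc, ← i.comm, reassoc_of% hir, Preadditive.add_comp,
      Category.assoc, Category.assoc, diskSum.inl_d, diskSum.inr_d, comp_zero, zero_add]
  have hif (n : ℤ) : i.f n ≫ diskSum.fst Q n =
      diskSum.fst L n ≫ l n + diskSum.snd L n ≫ t n := by
    apply diskSum.hom_X_ext <;> simp [reassoc_of% hil, reassoc_of% hir]
  have his (n : ℤ) : i.f n ≫ diskSum.snd Q n = diskSum.snd L n ≫ l (n + 1) := by
    apply diskSum.hom_X_ext <;> simp [reassoc_of% hil, reassoc_of% hir]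
  have w : i ≫ π = 0 := diskSum.hom_ext fun n => by
    rw [HomologicalComplex.comp_f, reassoc_of% hir, Preadditive.add_comp, Category.assoc,
      Category.assoc, hπl, hπr, ht, neg_add_cancel]
    simp
  refine ⟨L, Q, i, π, w, hL, hQ,
    HomologicalComplex.shortExact_of_degreewise_shortExact _ fun n => ?_⟩
  have hlinj (n : ℤ) : Function.Injective (l n) := (hSES n).moduleCat_injective_f
  have hιinj (n : ℤ) : Function.Injective (kernel.ι (F.d n (n + 1))) :=
    (ModuleCat.mono_iff_injective _).1 inferInstance
  have hlex (n : ℤ) (x : Q n) (hx : a n x = 0) : ∃ y, l n y = x :=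
    (ShortComplex.moduleCat_exact_iff _).1 (hSES n).exact x (hιinj n (hx.trans (map_zero _).symm))
  have haex (n : ℤ) (x : F.X n) (hx : F.d n (n + 1) x = 0) : ∃ y, a n y = x := by
    obtain ⟨z, hz⟩ := (ShortComplex.moduleCat_exact_iff _).1
      (ShortComplex.exact_kernel (F.d n (n + 1))) x hx
    obtain ⟨y, hy⟩ := (hSES n).moduleCat_surjective_g z
    exact ⟨y, (congrArg (kernel.ι (F.d n (n + 1))) hy).trans hz⟩
  have had (n : ℤ) (x : Q n) : F.d n (n + 1) (a n x) = 0 := by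
    have : a n ≫ F.d n (n + 1) = 0 := by rw [Category.assoc, kernel.condition, comp_zero]
    rw [← ModuleCat.comp_apply, this]; rfl
  have hπ (x : (diskSum Q).X n) :
      π.f n x = a n (diskSum.fst Q n x) + b n (diskSum.snd Q n x) := by
    have h : π.f n = diskSum.fst Q n ≫ a n + diskSum.snd Q n ≫ b n := by
      apply diskSum.hom_X_ext <;> simp [hπl, hπr]
    rw [h]; rfl
  have hbd (x : Q (n + 1)) : F.d n (n + 1) (b n x) = a (n + 1) x := by
    rw [← ModuleCat.comp_apply, hb]
  refine
    { exact := ?_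
      mono_f := ?_
      epi_g := ?_ }
  · rw [ShortComplex.moduleCat_exact_iff]
    intro (x : (diskSum Q).X n) (hx : π.f n x = 0)
    rw [hπ] at hx
    obtain ⟨y₂, hy₂⟩ := hlex (n + 1) (diskSum.snd Q n x) (by
      have := congrArg (F.d n (n + 1)) hx
      rwa [map_add, had, zero_add, hbd, map_zero] at this)
    obtain ⟨y₁, hy₁⟩ := hlex n (diskSum.fst Q n x - t n y₂) (by
      have := ConcreteCategory.congr_hom (ht n) y₂
      rw [ModuleCat.comp_apply] at this
      rw [map_sub, this]
      change _ - (-(b n (l (n + 1) y₂))) = 0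
      rw [hy₂, sub_neg_eq_add, hx])
    refine ⟨diskSum.inl L n y₁ + diskSum.inr L n y₂, diskSum.X_ext ?_ ?_⟩
    · change (i.f n ≫ diskSum.fst Q n) _ = _
      rw [hif]
      change l n (y₁ + 0) + t n (0 + y₂) = _
      rw [add_zero, zero_add, hy₁, sub_add_cancel]
    · change (i.f n ≫ diskSum.snd Q n) _ = _
      rw [his]
      change l (n + 1) (0 + y₂) = _
      rw [zero_add, hy₂]
  · refine (ModuleCat.mono_iff_injective (i.f n)).2 fun x y hxy => ?_
    have h₂ : diskSum.snd L n x = diskSum.snd L n y := by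
      apply hlinj
      rw [← ModuleCat.comp_apply, ← his, ModuleCat.comp_apply, hxy, ← ModuleCat.comp_apply, his,
        ModuleCat.comp_apply]
    refine diskSum.X_ext (hlinj n ?_) h₂
    have h : (i.f n ≫ diskSum.fst Q n) x = (i.f n ≫ diskSum.fst Q n) y := by
      rw [ModuleCat.comp_apply, hxy, ModuleCat.comp_apply]
    rw [hif] at h
    change l n (diskSum.fst L n x) + t n (diskSum.snd L n x) =
      l n (diskSum.fst L n y) + t n (diskSum.snd L n y) at h
    rw [h₂] at h
    exact add_right_cancel h
  · refine (ModuleCat.epi_iff_surjective (π.f n)).2 fun y => ?_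
    obtain ⟨x₂, hx₂⟩ := haex (n + 1) (F.d n (n + 1) y) (by
      rw [← ModuleCat.comp_apply, F.d_comp_d]; rfl)
    obtain ⟨x₁, hx₁⟩ := haex n (y - b n x₂) (by rw [map_sub, hbd, hx₂, sub_self])
    refine ⟨diskSum.inl Q n x₁ + diskSum.inr Q n x₂, ?_⟩
    rw [hπ]
    change a n (x₁ + 0) + b n (0 + x₂) = y
    rw [add_zero, zero_add, hx₁, sub_add_cancel]

/-- Strongly flat complexes lift along epimorphisms of complexes whose kernel `C` has weakly
cotorsion terms. As the source has projective dimension at most one, the obstruction to lifting is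
the image of one for the sum of disks on the terms of `C`, which surjects onto `C`; there it
vanishes, because extending a morphism into a sum of disks is a degreewise problem. -/
lemma SStronglyFlatComplex.exists_lift
    [HasProjectiveDimensionLT (ModuleCat.of R (Localization S)) 2]
    {F E M : CochainComplex (ModuleCat.{u} R) ℤ} (hF : SStronglyFlatComplex S F) (p : E ⟶ M)
    [Epi p] (hp : ∀ n, SWeaklyCotorsion S ((kernel p).X n)) (g : F ⟶ M) :
    ∃ h : F ⟶ E, h ≫ p = g := by
  obtain ⟨L, Q, i, π, w, hL, hQ, hT⟩ := hF.exists_diskSum_resolution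
  have := diskSum.projective (Q := L)
  have := diskSum.projective (Q := Q)
  have hπ : Epi π := hT.epi_g
  let C := kernel p
  let e : diskSum (fun n => C.X (n - 1)) ⟶ C := diskSum.descShift fun n => 𝟙 (C.X n)
  have he : Epi e := diskSum.epi_descShift _
  let g₀ : diskSum Q ⟶ E := Projective.factorThru (π ≫ g) p
  have hg₀ : g₀ ≫ p = π ≫ g := Projective.factorThru_comp _ _
  let k : diskSum L ⟶ C := kernel.lift p (i ≫ g₀) (by
    rw [Category.assoc, hg₀, reassoc_of% w, zero_comp])
  have hk : k ≫ kernel.ι p = i ≫ g₀ := kernel.lift_ι _ _ _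
  let k' : diskSum L ⟶ diskSum (fun n => C.X (n - 1)) := Projective.factorThru k e
  have hk' : k' ≫ e = k := Projective.factorThru_comp _ _
  have hγ (n : ℤ) : ∃ γ : (diskSum Q).X n ⟶ C.X (n - 1),
      i.f n ≫ γ = k'.f n ≫ diskSum.fst _ n :=
    ((HomologicalComplex.shortExact_iff_degreewise_shortExact _).1 hT
      n).exists_extension_of_ext_one (hF.stronglyFlat_X n _ (hp (n - 1))) _
  choose γ hγ using hγ
  have hik : i ≫ diskSum.lift γ = k' := diskSum.hom_ext' fun n => by
    rw [HomologicalComplex.comp_f, Category.assoc, diskSum.lift_fst, hγ]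
  have hi : i ≫ (g₀ - diskSum.lift γ ≫ e ≫ kernel.ι p) = 0 := by
    rw [Preadditive.comp_sub, reassoc_of% hik, reassoc_of% hk', hk, sub_self]
  refine ⟨hT.exact.desc _ hi, ?_⟩
  rw [← cancel_epi π]
  have h := hT.exact.g_desc _ hi
  change π ≫ _ = _ at h
  rw [reassoc_of% h, Preadditive.sub_comp, hg₀, Category.assoc, Category.assoc, kernel.condition,
    comp_zero, comp_zero, sub_zero]

end StronglyFlatComplex

/-! ### Copowers -/

section Copower

variable {R : Type u} [CommRing R] {S : Submonoid R}

/-- The functor sending a module to the direct sum of copies of it indexed by `I`. -/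
noncomputable def copower (R : Type u) [CommRing R] (I : Type u) :
    ModuleCat.{u} R ⥤ ModuleCat.{u} R where
  obj M := ModuleCat.of R (I →₀ M)
  map f := ModuleCat.ofHom (Finsupp.mapRange.linearMap f.hom)

namespace copower

variable {I : Type u} {M N : ModuleCat.{u} R}

/-- The inclusion of a summand. -/
noncomputable def ι (M : ModuleCat.{u} R) (x : I) : M ⟶ (copower R I).obj M :=
  ModuleCat.ofHom (Finsupp.lsingle x)

/-- The morphism out of a direct sum of copies of `M` defined by a family of morphisms. -/
noncomputable def desc (f : I → (M ⟶ N)) : (copower R I).obj M ⟶ N :=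
  ModuleCat.ofHom (Finsupp.lsum R fun x => (f x).hom)

lemma ι_desc (f : I → (M ⟶ N)) (x : I) : ι M x ≫ desc f = f x := by
  ext m
  exact Finsupp.sum_single_index (map_zero (f x).hom)

lemma ι_map (f : M ⟶ N) (x : I) : ι M x ≫ (copower R I).map f = f ≫ ι N x := by
  ext m
  exact Finsupp.mapRange_single (hf := map_zero f.hom)

lemma hom_ext {f g : (copower R I).obj M ⟶ N} (h : ∀ x, ι M x ≫ f = ι M x ≫ g) : f = g := by
  ext1
  exact Finsupp.lhom_ext' fun x => congrArg ModuleCat.Hom.hom (h x)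

lemma projective [Projective M] : Projective ((copower R I).obj M) where
  factors f e _ :=
    ⟨desc fun x => Projective.factorThru (ι M x ≫ f) e, hom_ext fun x => by
      rw [← Category.assoc, ι_desc, Projective.factorThru_comp]⟩

lemma isIso_smul {s : R} (h : IsIso (s • 𝟙 M)) : IsIso (s • 𝟙 ((copower R I).obj M)) := by
  have : s • 𝟙 ((copower R I).obj M) = (copower R I).map (s • 𝟙 M) :=
    hom_ext fun x => by
      rw [ι_map, Linear.comp_smul, Linear.smul_comp, Category.comp_id, Category.id_comp]
  rw [this]
  infer_instance

lemma map_comp_map_eq_zero {L : ModuleCat.{u} R} {f : L ⟶ M} {g : M ⟶ N} (w : f ≫ g = 0) :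
    (copower R I).map f ≫ (copower R I).map g = 0 :=
  hom_ext fun x => by
    rw [← Category.assoc, ι_map, Category.assoc, ι_map, ← Category.assoc, w, zero_comp, comp_zero]

lemma shortExact_map {T : ShortComplex (ModuleCat.{u} R)} (hT : T.ShortExact) :
    (ShortComplex.mk ((copower R I).map T.f) ((copower R I).map T.g)
      (map_comp_map_eq_zero T.zero)).ShortExact := by
  have hf := hT.moduleCat_injective_f
  have hg := hT.moduleCat_surjective_g
  have hex := (ShortComplex.moduleCat_exact_iff _).1 hT.exact
  refine
    { exact := ?_
      mono_f := ?_
      epi_g := ?_ }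
  · rw [ShortComplex.moduleCat_exact_iff]
    intro (x : I →₀ T.X₂) (hx : Finsupp.mapRange T.g (map_zero T.g.hom) x = 0)
    have h (i : I) : ∃ y, T.f y = x i := hex _ (DFunLike.congr_fun hx i)
    choose y hy using h
    classical
    refine ⟨Finsupp.onFinset x.support y fun i hi => ?_, ?_⟩
    · rw [Finsupp.mem_support_iff, ← hy]
      exact fun h0 => hi (hf (h0.trans (map_zero T.f.hom).symm))
    · exact Finsupp.ext hy
  · refine (ModuleCat.mono_iff_injective _).2 ?_
    exact Finsupp.mapRange_injective _ (map_zero T.f.hom) hf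
  · refine (ModuleCat.epi_iff_surjective _).2 ?_
    exact Finsupp.mapRange_surjective _ (map_zero T.g.hom) hg

end copower

lemma SStronglyFlat.copower_localization (I : Type u) :
    SStronglyFlat S ((copower R I).obj (ModuleCat.of R (Localization S))) := by
  intro C hC
  let T := syzygySequence (ModuleCat.of R (Localization S))
  have hT : T.ShortExact := syzygySequence_shortExact _
  have hU := copower.shortExact_map (I := I) hT
  have : Projective ((copower R I).obj T.X₂) := copower.projective
  refine hU.subsingleton_ext_one_of_exists_extension
    fun (f : (copower R I).obj T.X₁ ⟶ C) => ?_
  have hg (x : I) : ∃ g : T.X₂ ⟶ C, T.f ≫ g = copower.ι _ x ≫ f :=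
    hT.exists_extension_of_ext_one hC _
  choose g hg using hg
  refine ⟨copower.desc g, copower.hom_ext fun x => ?_⟩
  rw [← Category.assoc, copower.ι_map, Category.assoc, copower.ι_desc, hg]

end Copower

/-! ### Construction of the precover -/

section Precover

variable {R : Type u} [CommRing R] {S : Submonoid R}

lemma SWeaklyCotorsion.diskSum_copower_localization (I : ℤ → Type u) (n : ℤ) :
    SWeaklyCotorsion S
      ((diskSum fun j => (copower R (I j)).obj (ModuleCat.of R (Localization S))).X n) := by
  refine subsingleton_ext_one_localization _ fun s hs => ?_
  have h : IsIso ((s : R) • 𝟙 (ModuleCat.of R (Localization S))) := by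
    rw [ConcreteCategory.isIso_iff_bijective, ← Module.End.isUnit_iff]
    exact IsLocalizedModule.map_units (Algebra.linearMap R (Localization S)) ⟨s, hs⟩
  exact diskSum.isIso_smul (fun j => copower.isIso_smul h) n

/-- Every complex `M` is a quotient of a strongly flat complex by a complex with weakly cotorsion
terms. For projective modules `Q n` with `diskSum Q ↠ M` of kernel `K` and `0 → B → A → R_S → 0`
with `A` projective, the strongly flat complex is obtained from `diskSum Q` by pushing out sums of
copies of `B → A` in disks along all morphisms from `B` to the terms of `K`. -/
lemma exists_epi_stronglyFlatComplex (S : Submonoid R) (M : CochainComplex (ModuleCat.{u} R) ℤ) :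
    ∃ (F : CochainComplex (ModuleCat.{u} R) ℤ) (p : F ⟶ M), Epi p ∧ SStronglyFlatComplex S F ∧
      ∀ n, SWeaklyCotorsion S ((kernel p).X n) := by
  let T := syzygySequence (ModuleCat.of R (Localization S))
  have hT : T.ShortExact := syzygySequence_shortExact _
  let Q : ℤ → ModuleCat.{u} R := fun j => Projective.over (M.X (j - 1))
  have hQ (j : ℤ) : Projective (Q j) := inferInstanceAs (Projective (Projective.over _))
  let π : diskSum Q ⟶ M :=
    diskSum.descShift (G := fun n => Projective.over (M.X n)) fun n => Projective.π (M.X n)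
  have hπ : Epi π := diskSum.epi_descShift _
  let I (n : ℤ) : Type u := {f : T.X₁ ⟶ (diskSum Q).X n // f ≫ π.f n = 0}
  let φ (j : ℤ) := (copower R (I (j - 1))).map T.f
  let ψ (j : ℤ) := (copower R (I (j - 1))).map T.g
  have hU := diskSum.shortExact_map (φ := φ) (ψ := ψ) _
    fun j => copower.shortExact_map (I := I (j - 1)) hT
  have hU_zero : diskSum.map φ ≫ diskSum.map ψ = 0 :=
    diskSum.map_comp_map_eq_zero fun j => copower.map_comp_map_eq_zero T.zero
  let β (n : ℤ) : (copower R (I n)).obj T.X₁ ⟶ (diskSum Q).X n := copower.desc fun f => f.1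
  let b : diskSum (fun j => (copower R (I (j - 1))).obj T.X₁) ⟶ diskSum Q :=
    diskSum.descShift (G := fun n => (copower R (I n)).obj T.X₁) β
  have hb (n : ℤ) : diskSum.inr (fun j => (copower R (I (j - 1))).obj T.X₁) n ≫ b.f n =
      eqToHom (by rw [add_sub_cancel_right]) ≫ β n :=
    diskSum.inr_descShift (G := fun n => (copower R (I n)).obj T.X₁) β n
  have hβπ (n : ℤ) : β n ≫ π.f n = 0 := copower.hom_ext fun f => by
    rw [← Category.assoc, copower.ι_desc, f.2, comp_zero]
  have hbπ : b ≫ π = 0 := diskSum.hom_ext fun n => by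
    rw [HomologicalComplex.comp_f, reassoc_of% hb, hβπ]
    simp
  let F := pushout (diskSum.map φ) b
  let inA : diskSum (fun j => (copower R (I (j - 1))).obj T.X₂) ⟶ F := pushout.inl _ _
  let inQ : diskSum Q ⟶ F := pushout.inr _ _
  have hcond : diskSum.map φ ≫ inA = b ≫ inQ := pushout.condition
  let p : F ⟶ M := pushout.desc 0 π (by rw [comp_zero, hbπ])
  have hAp : inA ≫ p = 0 := pushout.inl_desc _ _ _
  have hQp : inQ ≫ p = π := pushout.inr_desc _ _ _
  let q : F ⟶ diskSum (fun j => (copower R (I (j - 1))).obj T.X₃) :=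
    pushout.desc (diskSum.map ψ) 0 (by rw [comp_zero]; exact hU_zero)
  have hAq : inA ≫ q = diskSum.map ψ := pushout.inl_desc _ _ _
  have hQq : inQ ≫ q = 0 := pushout.inr_desc _ _ _
  have hW : (ShortComplex.mk inQ q hQq).ShortExact :=
    hU.of_isPushout (IsPushout.of_hasPushout (diskSum.map φ) b) hAq hQq
  have hp : Epi p := by
    have : Epi (inQ ≫ p) := hQp ▸ hπ
    exact epi_of_epi inQ p
  refine ⟨F, p, hp, SStronglyFlatComplex.of_shortExact_diskSum hW
    (fun n => SStronglyFlat.of_projective _)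
    (fun n => SStronglyFlat.copower_localization _), fun n => ?_⟩
  have hQqn : inQ.f n ≫ q.f n = 0 := by
    rw [← HomologicalComplex.comp_f, hQq]; rfl
  have hWn : (ShortComplex.mk (inQ.f n) (q.f n) hQqn).ShortExact :=
    (HomologicalComplex.shortExact_iff_degreewise_shortExact _).1 hW n
  have hψ : Epi ((diskSum.map ψ).f n) :=
    ((HomologicalComplex.shortExact_iff_degreewise_shortExact _).1 hU n).epi_g
  have hAqn : inA.f n ≫ q.f n = (diskSum.map ψ).f n := by
    rw [← HomologicalComplex.comp_f, hAq]
  have hApn : inA.f n ≫ p.f n = 0 := by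
    rw [← HomologicalComplex.comp_f, hAp]; rfl
  have hQpn : inQ.f n ≫ p.f n = π.f n := by
    rw [← HomologicalComplex.comp_f, hQp]
  have hιp : (kernel.ι p).f n ≫ p.f n = 0 := by
    rw [← HomologicalComplex.comp_f, kernel.condition]; rfl
  refine hT.subsingleton_ext_one_of_exists_extension fun f => ?_
  -- The image of `f` in the term of the disks on copies of `R_S` extends to `T.X₂`.
  obtain ⟨g₁, hg₁⟩ : ∃ g₁ : T.X₂ ⟶ (diskSum fun j => (copower R (I (j - 1))).obj T.X₃).X n,
      T.f ≫ g₁ = f ≫ (kernel.ι p).f n ≫ q.f n :=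
    hT.exists_extension_of_ext_one
      (SWeaklyCotorsion.diskSum_copower_localization (fun j => I (j - 1)) n) _
  let g₂ : T.X₂ ⟶ F.X n := Projective.factorThru g₁ ((diskSum.map ψ).f n) ≫ inA.f n
  have hg₂q : g₂ ≫ q.f n = g₁ := by
    rw [Category.assoc, hAqn, Projective.factorThru_comp]
  have hg₂p : g₂ ≫ p.f n = 0 := by
    rw [Category.assoc, hApn, comp_zero]
  -- The difference takes values in the kernel of `π`, hence is one of the morphisms in `I n`.
  have hd : (f ≫ (kernel.ι p).f n - T.f ≫ g₂) ≫ q.f n = 0 := by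
    rw [Preadditive.sub_comp, Category.assoc, Category.assoc, hg₂q, hg₁, sub_self]
  have : Mono (inQ.f n) := hWn.mono_f
  let k : T.X₁ ⟶ (diskSum Q).X n := hWn.exact.lift _ hd
  have hk : k ≫ inQ.f n = f ≫ (kernel.ι p).f n - T.f ≫ g₂ := hWn.exact.lift_f _ hd
  have hkπ : k ≫ π.f n = 0 := by
    rw [← hQpn, ← Category.assoc, hk, Preadditive.sub_comp, Category.assoc, Category.assoc, hιp,
      hg₂p, comp_zero, comp_zero, sub_zero]
  let x : I n := ⟨k, hkπ⟩
  have hI : (copower R (I n)).obj T.X₂ = (copower R (I (n + 1 - 1))).obj T.X₂ := by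
    rw [add_sub_cancel_right]
  have hI' : (copower R (I n)).obj T.X₁ = (copower R (I (n + 1 - 1))).obj T.X₁ := by
    rw [add_sub_cancel_right]
  let g₃ : T.X₂ ⟶ F.X n := copower.ι T.X₂ x ≫ eqToHom hI ≫
    diskSum.inr (fun j => (copower R (I (j - 1))).obj T.X₂) n ≫ inA.f n
  have hg₃ : T.f ≫ g₃ = k ≫ inQ.f n := by
    have hφ : (copower R (I n)).map T.f ≫ eqToHom hI = eqToHom hI' ≫ φ (n + 1) := by
      have key : ∀ (m : ℤ) (_ : m = n)
          (h₁ : (copower R (I n)).obj T.X₂ = (copower R (I m)).obj T.X₂)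
          (h₂ : (copower R (I n)).obj T.X₁ = (copower R (I m)).obj T.X₁),
          (copower R (I n)).map T.f ≫ eqToHom h₁ = eqToHom h₂ ≫ (copower R (I m)).map T.f := by
        rintro m rfl _ _
        simp
      exact key _ (add_sub_cancel_right n 1) _ _
    have hcn : (diskSum.map φ).f n ≫ inA.f n = b.f n ≫ inQ.f n := by
      rw [← HomologicalComplex.comp_f, hcond, HomologicalComplex.comp_f]
    have hx : copower.ι T.X₁ x ≫ β n = k := copower.ι_desc _ x
    have hφr := diskSum.inr_map φ n
    simp only [g₃]
    rw [← Category.assoc, ← copower.ι_map, Category.assoc, reassoc_of% hφ, ← reassoc_of% hφr, hcn,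
      reassoc_of% hb, eqToHom_trans_assoc, eqToHom_refl, Category.id_comp, reassoc_of% hx]
  have hg₃p : g₃ ≫ p.f n = 0 := by
    simp only [g₃, Category.assoc, hApn, comp_zero]
  have hker : (ShortComplex.mk ((kernel.ι p).f n) (p.f n) hιp).Exact :=
    (HomologicalComplex.exact_iff_degreewise_exact _).1 (ShortComplex.exact_kernel p) n
  have : Mono ((kernel.ι p).f n) := inferInstance
  have hg : (g₂ + g₃) ≫ p.f n = 0 := by
    rw [Preadditive.add_comp, hg₂p, hg₃p, add_zero]
  refine ⟨hker.lift _ hg, ?_⟩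
  rw [← cancel_mono ((kernel.ι p).f n), Category.assoc]
  refine (congrArg (T.f ≫ ·) (hker.lift_f _ hg)).trans ?_
  change T.f ≫ (g₂ + g₃) = _
  rw [Preadditive.comp_add, hg₃, hk, add_sub_cancel]

end Precover

theorem mainTheorem6 {R : Type u} [CommRing R] (S : Submonoid R)
    (hpd : projectiveDimension (ModuleCat.of R (Localization S)) ≤ 1)
    (M : CochainComplex (ModuleCat.{u} R) ℤ) :
    ∃ (F : CochainComplex (ModuleCat.{u} R) ℤ) (f : F ⟶ M),
      IsPrecover (SStronglyFlatComplex S) f := by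
  have : HasProjectiveDimensionLT (ModuleCat.of R (Localization S)) 2 :=
    (projectiveDimension_le_iff _ 1).1 hpd
  obtain ⟨F, p, hp, hF, hC⟩ := exists_epi_stronglyFlatComplex S M
  exact ⟨F, p, hF, fun F' hF' g => hF'.exists_lift p hC g⟩
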